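/- **Definitions.** A *diagram* is a finite set $N$ with a symmetric matrix $B\in\mathbb Z^{N\times N}$ whose diagonal entries are even; it is a *graph* if all $B_{ij}\ge 0$ and all $B_{ii}=0$. Diagrams are considered up to relabelling of $N$. The Galois conjugates of a Puiseux polynomial $q=\sum_k a_kz^k$ (finitely many exponents $k\in\mathbb Q_{>0}$) are $\sum_k e^{2\pi i nk}a_kz^k$, $n\in\mathbb Z$; the set $\langle q\rangle$ of these is a *Stokes circle*. The *ramification order* $r$ of $q$ is the least integer $r\ge1$ such that $q\in\mathbb C[z^{1/r}]$, and the slope of $q$ is its largest exponent ($0$ if $q=0$). An algebraic connection on the affine line is an algebraic vector bundle with a connection $\nabla$, in a global frame $\nabla=d-A\,dz$ with $A$ a square matrix over $\mathbb C[z]$. Its *irregular class* at infinity is the finite multiset $\Theta=\sum n_iI_i$ of Stokes circles such that in a Turrittin–Levelt normal form $w'=(Q'+\Lambda/z)w$ of $v'=Av$ over some $\mathbb C((z^{-1/r}))$ (with $Q$ a diagonal matrix of Puiseux polynomials as above and $\Lambda$ a constant matrix commuting with $Q$) each $q$ occurs in the diagonal of $Q$ exactly as often as $\langle q\rangle$ occurs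 in $\Theta$. $\Theta$ is *untwisted* if all its circles have ramification order $1$. The *core diagram* $\Gamma_c(\Theta)$ has as vertices the distinct circles of $\Theta$, and the following multiplicities. * If $I=\langle q\rangle$ has ramification order $r$ and exponents $m_0/r>\dots>m_p/r$, put $g_j=\gcd(r,m_0,\dots,m_j)$ and $g_{-1}=r$; then $B_{I,I}=\sum_{j=0}^p m_j(g_{j-1}-g_j)-r^2+1$. * Let $I=\langle q\rangle\ne J=\langle q'\rangle$ have ramification orders $r,r'$. Let $c$ be the least element of $\frac1{\mathrm{lcm}(r,r')}\mathbb Z_{>0}$ such that the parts $q_c,q'_c$ of $q,q'$ with exponents $\ge c$ satisfy $\langle q_c\rangle=\langle q'_c\rangle$. Exchange $I$ and $J$ if necessary so that the slope $s_d/r$ of $q-q_c$ is at least that of $q'-q'_c$. Write the exponents of $q_c$ as $m_0/r=m_0'/r'>\dots>m_t/r=m_t'/r'$, and put $g'_j=\gcd(r',m'_0,\dots,m'_j)$ and $g'_{-1}=r'$ (with $t=-1$ if $q_c=0$). Then $B_{I,J}=B_{J,I}=\sum_{j=0}^t m_j(g'_{j-1}-g'_j)+s_dg'_t-rr'$. A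 *nonabelian Hodge graph* is a graph of the form $\Gamma_c(\Theta)$ with $\Theta$ the irregular class of an algebraic connection on the affine line. A *fission graph* is a diagram of the form $\Gamma_c(\Theta)$ with $\Theta$ the untwisted irregular class of such a connection. **Proposition.** There exist nonabelian Hodge graphs that are not fission graphs. Explicitly, for $a,b,c\in\mathbb C$ let $\nabla_{a,b,c}=d-A\,dz$ be the rank $6$ connection whose matrix $A$ is block diagonal with blocks $$\begin{pmatrix} a z^2\end{pmatrix},\qquad \begin{pmatrix}0&1&0\\0&0&1\\ bz&0&0\end{pmatrix},\qquad \begin{pmatrix}0&1\\ cz&0\end{pmatrix}.$$ Then: 1. $\nabla_{1,1,1}$ has irregular class $\Theta'=\langle \tfrac13z^3\rangle+\langle\tfrac34 z^{4/3}\rangle+\langle\tfrac23z^{3/2}\rangle$, and $\nabla_{3,\,64/27,\,9/4}$ has irregular class $\Theta=\langle z^3\rangle+\langle z^{4/3}\rangle+\langle z^{3/2}\rangle$. 2. The circles $I=\langle z^3\rangle$, $J=\langle z^{4/3}\rangle$, $K=\langle z^{3/2}\rangle$ are pairwise distinct, and $B_{I,I}=B_{J,J}=B_{K,K}=0$, $B_{I,J}=6$,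 $B_{J,K}=3$, $B_{K,I}=4$. 3. The core diagrams of $\Theta$ and of $\Theta'$ are both the loopless triangle with edge multiplicities $3,4,6$. 4. This triangle violates the ultrametric condition (for pairwise distinct vertices $i,j,k$, if $B_{ij}\le B_{ik}\le B_{jk}$ then $B_{ik}=B_{jk}$). It is a nonabelian Hodge graph and is not a fission graph. -/

import Mathlib

open scoped Polynomial

noncomputable section

namespace NAHodge

/-! ### Diagrams and graphs -/

/-- A diagram `(N, B)`: a finite set `N` with a symmetric integer matrix `B` indexed by `N` whose
diagonal entries are even. For `i ≠ j`, `B i j` is the number of edges between `i` and `j`, and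
`B i i / 2` is the number of loops at `i` (all of these may be negative). -/
structure Diagram where
  N : Type
  finite_N : Finite N
  B : N → N → ℤ
  symm : ∀ i j, B i j = B j i
  even_loop : ∀ i, Even (B i i)

/-- A graph is a diagram without loops and without negative edges. -/
def Diagram.IsGraph (Γ : Diagram) : Prop :=
  (∀ i j, 0 ≤ Γ.B i j) ∧ ∀ i, Γ.B i i = 0

/-- The ultrametric condition on edge multiplicities: in every triangle, the two largest edge
multiplicities are equal. -/
def Diagram.IsUltrametric (Γ : Diagram) : Prop :=
  ∀ i j k : Γ.N, i ≠ j → i ≠ k → j ≠ k →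
    Γ.B i j ≤ Γ.B i k → Γ.B i k ≤ Γ.B j k → Γ.B i k = Γ.B j k

/-! ### Exponential factors and Stokes circles -/

/-- Positive rational numbers: the possible exponents. -/
abbrev Exponent : Type := {k : ℚ // 0 < k}

/-- An exponential factor at infinity: a Puiseux polynomial `q = ∑ₖ aₖ z ^ k` in `z` with finitely
many exponents `k`, all of them positive rational numbers, and complex coefficients. -/
abbrev ExpFactor : Type := Exponent →₀ ℂ

/-- Two exponential factors are Galois conjugate if one is obtained from the other by going `n`
times around infinity, which multiplies `z ^ k` by `exp (2 π i n k)`. -/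
def GaloisConj (q q' : ExpFactor) : Prop :=
  ∃ n : ℤ, ∀ k : Exponent,
    q' k = Complex.exp (2 * Real.pi * Complex.I * n * ((k : ℚ) : ℂ)) * q k

theorem GaloisConj.refl (q : ExpFactor) : GaloisConj q q := ⟨0, fun k => by simp⟩

theorem GaloisConj.symm {q q' : ExpFactor} (h : GaloisConj q q') : GaloisConj q' q := by
  obtain ⟨n, hn⟩ := h
  refine ⟨-n, fun k => ?_⟩
  rw [hn k, ← mul_assoc, ← Complex.exp_add]
  have : 2 * (Real.pi : ℂ) * Complex.I * ((-n : ℤ) : ℂ) * ((k : ℚ) : ℂ)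
      + 2 * Real.pi * Complex.I * n * ((k : ℚ) : ℂ) = 0 := by push_cast; ring
  rw [this, Complex.exp_zero, one_mul]

theorem GaloisConj.trans {q q' q'' : ExpFactor} (h : GaloisConj q q') (h' : GaloisConj q' q'') :
    GaloisConj q q'' := by
  obtain ⟨n, hn⟩ := h
  obtain ⟨m, hm⟩ := h'
  refine ⟨m + n, fun k => ?_⟩
  rw [hm k, hn k, ← mul_assoc, ← Complex.exp_add]
  congr 2
  push_cast
  ring

instance galoisSetoid : Setoid ExpFactor :=
  ⟨GaloisConj, GaloisConj.refl, GaloisConj.symm, GaloisConj.trans⟩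

/-- A Stokes circle `⟨q⟩`: the Galois orbit of an exponential factor `q`. -/
def StokesCircle : Type := Quotient galoisSetoid

/-- The Stokes circle `⟨q⟩` of an exponential factor `q`. -/
def circ (q : ExpFactor) : StokesCircle := Quotient.mk galoisSetoid q

/-- The monomial exponential factor `a z ^ k`. -/
def mono (a : ℂ) (k : ℚ) (hk : 0 < k) : ExpFactor := Finsupp.single ⟨k, hk⟩ a

theorem GaloisConj.support_eq {q q' : ExpFactor} (h : GaloisConj q q') :
    q'.support = q.support := by
  obtain ⟨n, hn⟩ := h
  ext k
  simp [hn k, Complex.exp_ne_zero]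

/-- The ramification order of `q`: the smallest `r ≥ 1` such that `q` is a polynomial in
`z ^ (1 / r)`, that is, the least common multiple of the denominators of its exponents. -/
def ram (q : ExpFactor) : ℕ := q.support.lcm fun k => (k : ℚ).den

theorem ram_isLeast (q : ExpFactor) :
    IsLeast {r : ℕ | 1 ≤ r ∧ ∀ k ∈ q.support, ∃ j : ℕ, (k : ℚ) = (j : ℚ) / (r : ℚ)} (ram q) := by
  have key : ∀ r : ℕ, 1 ≤ r → ∀ k : Exponent,
      (∃ j : ℕ, (k : ℚ) = (j : ℚ) / (r : ℚ)) ↔ (k : ℚ).den ∣ r := by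
    intro r hr k
    have hr0 : (r : ℚ) ≠ 0 := by positivity
    constructor
    · rintro ⟨j, hj⟩
      have := Rat.den_dvd (j : ℤ) (r : ℤ)
      rw [Rat.divInt_eq_div] at this
      push_cast at this
      rw [← hj] at this
      exact_mod_cast this
    · rintro ⟨c, hc⟩
      have hd : ((k : ℚ).den : ℚ) ≠ 0 := by exact_mod_cast (k : ℚ).den_nz
      have hc0 : (c : ℚ) ≠ 0 := by
        rintro h
        apply hr0
        rw [hc]; push_cast; rw [h, mul_zero]
      have hn : 0 ≤ (k : ℚ).num := Rat.num_nonneg.2 k.2.le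
      refine ⟨(k : ℚ).num.toNat * c, ?_⟩
      have h1 : (((k : ℚ).num.toNat : ℕ) : ℚ) = ((k : ℚ).num : ℚ) := by
        exact_mod_cast congrArg (Int.cast : ℤ → ℚ) (Int.toNat_of_nonneg hn)
      rw [hc]
      push_cast
      rw [h1, mul_div_mul_right _ _ hc0, Rat.num_div_den]
  have hpos : 1 ≤ ram q := by
    rw [Nat.one_le_iff_ne_zero, ram, Ne, Finset.lcm_eq_zero_iff]
    rintro ⟨k, -, hk⟩
    exact (k : ℚ).den_nz hk
  refine ⟨⟨hpos, fun k hk => (key _ hpos k).2 (Finset.dvd_lcm hk)⟩, ?_⟩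
  rintro r ⟨hr, h⟩
  exact Nat.le_of_dvd hr (Finset.lcm_dvd fun k hk => (key r hr k).1 (h k hk))

theorem GaloisConj.ram_eq {q q' : ExpFactor} (h : GaloisConj q q') : ram q' = ram q := by
  unfold ram; rw [h.support_eq]

/-- The slope of `q`: its largest exponent (and `0` if `q = 0`). -/
def slope (q : ExpFactor) : ℚ :=
  ((q.support.sup fun k => (k : ℚ).toNNRat : NNRat) : ℚ)

/-- The numerator `r k` of the exponent `k` written with denominator `r` (it is used only when
`r k` is an integer). -/
def numer (r : ℕ) (k : ℚ) : ℕ := ⌊(r : ℚ) * k⌋₊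

/-- The greatest common divisor of `r` and of all the `r k` for `k ∈ S`. -/
def gcdOf (r : ℕ) (S : Finset Exponent) : ℕ := Nat.gcd r (S.gcd fun k => numer r k)

/-- For a set of exponents `S = {k₀ > ⋯ > kₜ}` with `kⱼ = mⱼ / r = m'ⱼ / r'`, the sum
`∑ⱼ mⱼ (gcd (r', m'₀, …, m'ⱼ₋₁) - gcd (r', m'₀, …, m'ⱼ))`. -/
def levelSum (r r' : ℕ) (S : Finset Exponent) : ℤ :=
  ∑ k ∈ S, (numer r k : ℤ) *
    ((gcdOf r' (S.filter fun l => k < l) : ℤ) - (gcdOf r' (S.filter fun l => k ≤ l) : ℤ))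

/-- The loop multiplicity of `⟨q⟩`. For `q = 0` this is `0`. -/
def loopMult (q : ExpFactor) : ℤ :=
  levelSum (ram q) (ram q) q.support - (ram q : ℤ) ^ 2 + 1

/-- The truncation `τ_c q`: the monomials of `q` with exponent at least `c`. -/
def trunc (c : ℚ) (q : ExpFactor) : ExpFactor := q.filter fun k => c ≤ (k : ℚ)

/-- The smallest `c ∈ (1 / lcm (r, r')) ℤ_{>0}` such that `⟨τ_c q⟩ = ⟨τ_c q'⟩`. -/
def cutoff (q q' : ExpFactor) : ℚ :=
  ((sInf {m : ℕ | 0 < m ∧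
      circ (trunc ((m : ℚ) / (Nat.lcm (ram q) (ram q') : ℚ)) q) =
        circ (trunc ((m : ℚ) / (Nat.lcm (ram q) (ram q') : ℚ)) q')} : ℕ) : ℚ) /
    (Nat.lcm (ram q) (ram q') : ℚ)

/-- The part of `q` common with `q'`. -/
def commonPart (q q' : ExpFactor) : ExpFactor := trunc (cutoff q q') q

/-- The part of `q` different from `q'`, so that `q = commonPart q q' + diffPart q q'`. -/
def diffPart (q q' : ExpFactor) : ExpFactor := q - commonPart q q'

/-- The formula for the edge multiplicity of `⟨q⟩ ≠ ⟨q'⟩` when the different part of `q` has slope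
at least that of the different part of `q'`, so that this slope is the fission exponent. -/
def edgeFormula (q q' : ExpFactor) : ℤ :=
  levelSum (ram q) (ram q') (commonPart q q').support
    + (numer (ram q) (slope (diffPart q q')) : ℤ) * (gcdOf (ram q') (commonPart q q').support : ℤ)
    - (ram q : ℤ) * (ram q' : ℤ)

/-- The edge multiplicity of two exponential factors with distinct Stokes circles. -/
def edgeMult (q q' : ExpFactor) : ℤ :=
  if slope (diffPart q' q) ≤ slope (diffPart q q') then edgeFormula q q' else edgeFormula q' q

theorem GaloisConj.trunc {q q' : ExpFactor} (h : GaloisConj q q') (c : ℚ) :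
    GaloisConj (trunc c q) (trunc c q') := by
  obtain ⟨n, hn⟩ := h
  refine ⟨n, fun k => ?_⟩
  by_cases hk : c ≤ (k : ℚ) <;> simp [NAHodge.trunc, hk, hn k]

theorem GaloisConj.circ_eq {q q' : ExpFactor} (h : GaloisConj q q') : circ q = circ q' :=
  Quotient.sound h

theorem GaloisConj.cutoff_eq {p p' q q' : ExpFactor} (hp : GaloisConj p p')
    (hq : GaloisConj q q') : cutoff p' q' = cutoff p q := by
  unfold cutoff
  rw [hp.ram_eq, hq.ram_eq]
  simp only [← (hp.trunc _).circ_eq, ← (hq.trunc _).circ_eq]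

theorem GaloisConj.commonPart {p p' q q' : ExpFactor} (hp : GaloisConj p p')
    (hq : GaloisConj q q') : GaloisConj (commonPart p q) (commonPart p' q') := by
  unfold NAHodge.commonPart
  rw [hp.cutoff_eq hq]
  exact hp.trunc _

theorem GaloisConj.diffPart {p p' q q' : ExpFactor} (hp : GaloisConj p p')
    (hq : GaloisConj q q') : GaloisConj (diffPart p q) (diffPart p' q') := by
  unfold NAHodge.diffPart NAHodge.commonPart
  rw [hp.cutoff_eq hq]
  obtain ⟨n, hn⟩ := hp
  refine ⟨n, fun k => ?_⟩
  by_cases hk : NAHodge.cutoff p q ≤ (k : ℚ) <;> simp [NAHodge.trunc, hk, hn k]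

theorem GaloisConj.slope_eq {q q' : ExpFactor} (h : GaloisConj q q') : slope q' = slope q := by
  unfold slope; rw [h.support_eq]

theorem GaloisConj.loopMult_eq {q q' : ExpFactor} (h : GaloisConj q q') :
    loopMult q' = loopMult q := by
  unfold loopMult; rw [h.support_eq, h.ram_eq]

theorem GaloisConj.edgeFormula_eq {p p' q q' : ExpFactor} (hp : GaloisConj p p')
    (hq : GaloisConj q q') : edgeFormula p' q' = edgeFormula p q := by
  unfold edgeFormula
  rw [hp.ram_eq, hq.ram_eq, (hp.commonPart hq).support_eq, (hp.diffPart hq).slope_eq]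

theorem GaloisConj.edgeMult_eq {p p' q q' : ExpFactor} (hp : GaloisConj p p')
    (hq : GaloisConj q q') : edgeMult p' q' = edgeMult p q := by
  unfold edgeMult
  rw [hp.edgeFormula_eq hq, hq.edgeFormula_eq hp, (hp.diffPart hq).slope_eq,
    (hq.diffPart hp).slope_eq]

/-- The ramification order of a Stokes circle. -/
def StokesCircle.ram : StokesCircle → ℕ :=
  Quotient.lift NAHodge.ram fun _ _ h => (GaloisConj.ram_eq h).symm

/-- The loop multiplicity `B_{I,I}` of a Stokes circle. -/
def StokesCircle.loopMult : StokesCircle → ℤ :=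
  Quotient.lift NAHodge.loopMult fun _ _ h => (GaloisConj.loopMult_eq h).symm

/-- The edge multiplicity `B_{I,J}` of two distinct Stokes circles. -/
def StokesCircle.edgeMult : StokesCircle → StokesCircle → ℤ :=
  Quotient.lift₂ NAHodge.edgeMult fun _ _ _ _ h h' => (GaloisConj.edgeMult_eq h h').symm

open Classical in
/-- The multiplicity `B_{I,J}` of a pair of Stokes circles: the loop multiplicity if `I = J`, the
edge multiplicity otherwise. -/
def StokesCircle.mult (I J : StokesCircle) : ℤ :=
  if I = J then I.loopMult else I.edgeMult J

/-! ### Irregular classes and core diagrams -/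

/-- An irregular class at infinity: a finite multiset `Θ = ∑ nᵢ Iᵢ` of Stokes circles. -/
abbrev IrregularClass : Type := Multiset StokesCircle

/-- An irregular class is untwisted if all its Stokes circles have ramification order `1`. -/
def IrregularClass.IsUntwisted (Θ : IrregularClass) : Prop := ∀ I ∈ Θ, StokesCircle.ram I = 1

/-- `Γ = Γ_c(Θ)`: the vertices of `Γ` are identified with the distinct Stokes circles of `Θ`, in
such a way that the entries of the matrix of `Γ` are the multiplicities of pairs of circles. -/
def Diagram.IsCoreDiagramOf (Γ : Diagram) (Θ : IrregularClass) : Prop :=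
  ∃ e : Γ.N ≃ {I : StokesCircle // I ∈ Θ},
    ∀ i j, Γ.B i j = StokesCircle.mult (e i : StokesCircle) (e j : StokesCircle)

/-! ### Algebraic connections on the affine line -/

/-- An algebraic connection `(E, ∇)` on the complex affine line: a finitely generated projective
`ℂ[z]`-module `E` (an algebraic vector bundle) with an additive operator `∇ = ∇_{d/dz}` on `E`
satisfying the Leibniz rule (which makes it `ℂ`-linear). -/
structure AlgConnection where
  E : Type
  [addCommGroup : AddCommGroup E]
  [module : Module ℂ[X] E]
  [finite : Module.Finite ℂ[X] E]
  [projective : Module.Projective ℂ[X] E]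
  nabla : E →+ E
  leibniz : ∀ (f : ℂ[X]) (v : E),
    nabla (f • v) = Polynomial.derivative f • v + f • nabla v

attribute [instance] AlgConnection.addCommGroup AlgConnection.module AlgConnection.finite
  AlgConnection.projective

/-- The connection `∇ = d - A dz` on the trivial bundle of rank `n`. -/
def AlgConnection.ofMatrix {n : ℕ} (A : Matrix (Fin n) (Fin n) ℂ[X]) : AlgConnection where
  E := Fin n → ℂ[X]
  nabla :=
    { toFun := fun v => (fun i => Polynomial.derivative (v i)) - A.mulVec v
      map_zero' := by
        ext1 i
        simp
      map_add' := by
        intro v w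
        ext1 i
        simp [Matrix.mulVec_add]
        ring }
  leibniz := by
    intro f v
    ext1 i
    simp [Matrix.mulVec_smul, Polynomial.derivative_mul]
    ring

/-- The matrix `A` such that `∇ = d - A dz` in a basis `b` of `E`. -/
def AlgConnection.matrix (C : AlgConnection) {n : ℕ} (b : Module.Basis (Fin n) ℂ[X] C.E) :
    Matrix (Fin n) (Fin n) ℂ[X] :=
  Matrix.of fun i j => - b.repr (C.nabla (b j)) i

/-- The embedding of `ℂ[z]` in `ℂ((t))`, where `z = t ^ (-r)`. -/
def polyToLaurent (r : ℕ) : ℂ[X] →ₐ[ℂ] LaurentSeries ℂ :=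
  Polynomial.aeval (HahnSeries.single (-(r : ℤ)) (1 : ℂ) : LaurentSeries ℂ)

/-- The derivation `d/dz = -(1/r) t ^ (r+1) d/dt` of `ℂ((t))`, where `z = t ^ (-r)`. -/
def zDeriv (r : ℕ) (f : LaurentSeries ℂ) : LaurentSeries ℂ :=
  (HahnSeries.single ((r : ℤ) + 1) (-(1 / (r : ℂ))) : LaurentSeries ℂ) *
    LaurentSeries.hasseDeriv ℂ 1 f

/-- The exponential factor `q` as an element of `ℂ((t))`, where `z = t ^ (-r)` and the ramification
order of `q` divides `r`: the monomial `a z ^ k` becomes `a t ^ (- r k)`. -/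
def ExpFactor.toLaurent (r : ℕ) (q : ExpFactor) : LaurentSeries ℂ :=
  q.sum fun k a => HahnSeries.single (-(numer r k : ℤ)) a

/-- The Turrittin-Levelt normal form at infinity of the system `v' = A v`: after a pullback
`z = t ^ (-r)` and a gauge transformation `v = G w` with `G` an invertible matrix over `ℂ((t))`,
the system becomes `w' = (Q' + Λ / z) w`, where `' = d/dz`, `Q` is the diagonal matrix of the
exponential factors `q i` and `Λ` is a constant matrix commuting with `Q`. Thus a formal fundamental
matrix of solutions is `G z ^ Λ e ^ Q`. -/
def HasNormalForm {n : ℕ} (A : Matrix (Fin n) (Fin n) ℂ[X]) (q : Fin n → ExpFactor) : Prop :=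
  ∃ (r : ℕ) (G : Matrix (Fin n) (Fin n) (LaurentSeries ℂ)) (Λ : Matrix (Fin n) (Fin n) ℂ),
    1 ≤ r ∧ (∀ i, ram (q i) ∣ r) ∧ IsUnit G ∧ (∀ i j, q i ≠ q j → Λ i j = 0) ∧
    A.map (polyToLaurent r) * G - G.map (zDeriv r) =
      G * (Matrix.diagonal (fun i => zDeriv r ((q i).toLaurent r)) +
        Λ.map fun a => (HahnSeries.single (r : ℤ) a : LaurentSeries ℂ))

open Classical in
/-- `Θ` is the irregular class of the connection at infinity: in a normal form of the connection
at infinity, every exponential factor `p` occurs exactly as many times as its Stokes circle `⟨p⟩`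
occurs in `Θ`. -/
def AlgConnection.HasIrregularClass (C : AlgConnection) (Θ : IrregularClass) : Prop :=
  ∃ (n : ℕ) (b : Module.Basis (Fin n) ℂ[X] C.E) (q : Fin n → ExpFactor),
    HasNormalForm (C.matrix b) q ∧
    ∀ p : ExpFactor, Nat.card {i : Fin n // q i = p} = Multiset.count (circ p) Θ

/-- A nonabelian Hodge diagram: the core diagram of an algebraic connection on the affine line. -/
def Diagram.IsNonabelianHodgeDiagram (Γ : Diagram) : Prop :=
  ∃ (C : AlgConnection) (Θ : IrregularClass), C.HasIrregularClass Θ ∧ Γ.IsCoreDiagramOf Θ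

/-- A nonabelian Hodge graph: a nonabelian Hodge diagram that is a graph. -/
def Diagram.IsNonabelianHodgeGraph (Γ : Diagram) : Prop :=
  Γ.IsNonabelianHodgeDiagram ∧ Γ.IsGraph

/-- A fission graph: the core diagram of an algebraic connection on the affine line with untwisted
irregular class. -/
def Diagram.IsFissionGraph (Γ : Diagram) : Prop :=
  ∃ (C : AlgConnection) (Θ : IrregularClass), C.HasIrregularClass Θ ∧ Θ.IsUntwisted ∧
    Γ.IsCoreDiagramOf Θ

/-! ### The example -/

open Polynomial in
/-- The block diagonal matrix with the three blocks
`(a z²)`, `(0 1 0; 0 0 1; b z 0 0)` and `(0 1; c z 0)`. -/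
def exampleMatrix (a b c : ℂ) : Matrix (Fin 6) (Fin 6) ℂ[X] :=
  !![C a * X ^ 2, 0, 0, 0, 0, 0;
     0, 0, 1, 0, 0, 0;
     0, 0, 0, 1, 0, 0;
     0, C b * X, 0, 0, 0, 0;
     0, 0, 0, 0, 0, 1;
     0, 0, 0, 0, C c * X, 0]

/-- The loopless triangle with edge multiplicities `3`, `4`, `6`. -/
def triangle346 : Diagram where
  N := Fin 3
  finite_N := inferInstance
  B := !![0, 6, 4; 6, 0, 3; 4, 3, 0]
  symm := by intro i j; fin_cases i <;> fin_cases j <;> rfl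
  even_loop := by intro i; fin_cases i <;> exact ⟨0, rfl⟩

end NAHodge

end

open NAHodge

open scoped PowerSeries

noncomputable section

namespace NAHodge

/-! ### Formal solutions of the two irreducible blocks -/

/-! An untwisted circle is a single polynomial `q` without constant term, and for two of them the
multiplicity collapses to `deg (q - q') - 1` (`exists_edgeMult_eq`). Since `deg (p - q)` is at most
the larger of `deg (p - s)` and `deg (q - s)`, fission graphs are ultrametric
(`mult_le_max_of_ram_eq_one`, `Diagram.IsFissionGraph.isUltrametric`), which excludes a triangle
with edges 3, 4, 6.

Ramification breaks this. Monomial circles of slopes `k > k'` and ramification orders `r`, `r'` have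
nothing in common, so they are joined by `r r' (k - 1)` edges. The slopes 3, 4/3, 3/2 with orders 1,
3, 2 give 6, 3, 4 (`mult_example`).

To realise these circles, read the blocks as the scalar equations `y' = a z² y`, `y''' = b z y`,
`y'' = c z y`. The last two have the formal solutions `z^(-1/3) exp (3/4 β z^(4/3)) P(z^(-4/3))`
with `β³ = b` and `z^(-1/4) exp (2/3 γ z^(3/2)) P(z^(-3/2))` with `γ² = c`, where `P` comes from a
recursion on coefficients (`exists_cubic_series`, `exists_airy_series`). Letting the root vary gives
the columns of a gauge matrix, invertible because the leading coefficients form Vandermonde matrices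
(`hasNormalForm_exampleMatrix`). The exponential factors found in this way fill out exactly three
Galois orbits (`circ_eq_circ_mono`, `hasIrregularClass_exampleMatrix`). -/

/-- The embedding of `ℂ⟦x⟧` in `ℂ((t))` sending `x` to `t ^ m`. -/
def powEmb (m : ℕ) [NeZero m] : ℂ⟦X⟧ →+* LaurentSeries ℂ :=
  (HahnSeries.embDomainRingHom (R := ℂ)
    ((AddMonoidHom.mulLeft (m : ℤ)).comp (Nat.castAddMonoidHom ℤ))
    (fun a b h => by
      simpa [NeZero.ne m] using h)
    (fun a b => by
      have : (0 : ℤ) < m := by exact_mod_cast Nat.pos_of_ne_zero (NeZero.ne m)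
      simp only [AddMonoidHom.coe_comp, Function.comp_apply, AddMonoidHom.coe_mulLeft,
        Nat.coe_castAddMonoidHom]
      rw [mul_le_mul_iff_right₀ this, Nat.cast_le])).comp
  (HahnSeries.toPowerSeries (R := ℂ)).symm.toRingHom

theorem powEmb_coeff_mul (m : ℕ) [NeZero m] (P : ℂ⟦X⟧) (k : ℕ) :
    (powEmb m P).coeff (m * k) = PowerSeries.coeff k P := by
  unfold powEmb
  rw [← HahnSeries.coeff_toPowerSeries_symm (f := P)]
  exact HahnSeries.embDomain_coeff (a := k)

theorem powEmb_coeff_eq_zero (m : ℕ) [NeZero m] (P : ℂ⟦X⟧) {n : ℤ}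
    (hn : ∀ k : ℕ, n ≠ m * k) : (powEmb m P).coeff n = 0 := by
  unfold powEmb
  refine HahnSeries.embDomain_of_notMem_range ?_
  rintro ⟨k, hk⟩
  exact hn k (by simpa using hk.symm)

theorem powEmb_injective (m : ℕ) [NeZero m] : Function.Injective (powEmb m) := by
  intro P Q h
  ext k
  rw [← powEmb_coeff_mul m P, h, powEmb_coeff_mul]

theorem powEmb_X_mul (m : ℕ) [NeZero m] (P : ℂ⟦X⟧) :
    powEmb m (PowerSeries.X * P) = HahnSeries.single (m : ℤ) 1 * powEmb m P := by
  ext n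
  rw [HahnSeries.coeff_single_mul, one_mul]
  by_cases h : ∃ k : ℕ, n = m * k
  · obtain ⟨k, rfl⟩ := h
    rw [powEmb_coeff_mul]
    rcases k with _ | k
    · rw [powEmb_coeff_eq_zero]
      · simp
      · intro k hk
        have : (0 : ℤ) < m := by exact_mod_cast Nat.pos_of_ne_zero (NeZero.ne m)
        have : (0 : ℤ) ≤ m * k := by positivity
        simp at hk
        omega
    · rw [PowerSeries.coeff_succ_X_mul, ← powEmb_coeff_mul m]
      congr 1
      push_cast
      ring
  · push Not at h
    rw [powEmb_coeff_eq_zero _ _ h, powEmb_coeff_eq_zero]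
    intro k hk
    apply h (k + 1)
    push_cast
    linarith

theorem powEmb_smul (m : ℕ) [NeZero m] (c : ℂ) (P : ℂ⟦X⟧) :
    powEmb m (c • P) = HahnSeries.single 0 c * powEmb m P := by
  ext n
  rw [HahnSeries.coeff_single_mul, sub_zero]
  by_cases h : ∃ k : ℕ, n = m * k
  · obtain ⟨k, rfl⟩ := h
    simp [powEmb_coeff_mul]
  · push Not at h
    rw [powEmb_coeff_eq_zero _ _ h, powEmb_coeff_eq_zero _ _ h, mul_zero]

/-! ### The derivation `d/dz` on series `t ^ n P(t ^ m)` -/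

theorem zDeriv_coeff (r : ℕ) (f : LaurentSeries ℂ) (n : ℤ) :
    (zDeriv r f).coeff n = -(1 / (r : ℂ)) * (((n - r : ℤ) : ℂ) * f.coeff (n - r)) := by
  rw [zDeriv, HahnSeries.coeff_single_mul, LaurentSeries.hasseDeriv_coeff]
  have h : n - ((r : ℤ) + 1) + (1 : ℕ) = n - r := by push_cast; ring
  rw [h, Ring.choose_one_right, zsmul_eq_mul]

theorem zDeriv_single (r : ℕ) (n : ℤ) (a : ℂ) :
    zDeriv r (HahnSeries.single n a) = HahnSeries.single (n + r) (-(n / r) * a) := by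
  ext k
  rw [zDeriv_coeff]
  by_cases h : k = n + r
  · subst h
    simp
    ring
  · rw [HahnSeries.coeff_single_of_ne h, HahnSeries.coeff_single_of_ne (by omega)]
    simp

@[simp]
theorem zDeriv_zero (r : ℕ) : zDeriv r 0 = 0 := by
  simp [zDeriv]

/-- The series `t ^ n P(t ^ m)`. -/
def powSeries (n : ℤ) (m : ℕ) [NeZero m] (P : ℂ⟦X⟧) : LaurentSeries ℂ :=
  HahnSeries.single n 1 * powEmb m P

/-- The power series `β P + x (a - μ x d/dx) P`. -/
def eulerStep (β a μ : ℂ) (P : ℂ⟦X⟧) : ℂ⟦X⟧ :=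
  β • P + PowerSeries.X * PowerSeries.mk fun k => (a - μ * k) * PowerSeries.coeff k P

theorem coeff_zero_eulerStep (β a μ : ℂ) (P : ℂ⟦X⟧) :
    PowerSeries.coeff 0 (eulerStep β a μ P) = β * PowerSeries.coeff 0 P := by
  simp [eulerStep]

theorem coeff_succ_eulerStep (β a μ : ℂ) (P : ℂ⟦X⟧) (k : ℕ) :
    PowerSeries.coeff (k + 1) (eulerStep β a μ P) =
      β * PowerSeries.coeff (k + 1) P + (a - μ * k) * PowerSeries.coeff k P := by
  simp [eulerStep, PowerSeries.coeff_succ_X_mul]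

theorem zDeriv_powSeries (r : ℕ) (n : ℤ) (m : ℕ) [NeZero m] (P : ℂ⟦X⟧) :
    zDeriv r (powSeries n m P) = powSeries (n + r) m
      (PowerSeries.mk fun k => (-(n / r : ℂ) - m / r * k) * PowerSeries.coeff k P) := by
  ext N
  rw [zDeriv_coeff, powSeries, powSeries, HahnSeries.coeff_single_mul, HahnSeries.coeff_single_mul]
  have hN : N - (n + r) = N - r - n := by ring
  rw [hN]
  by_cases h : ∃ k : ℕ, N - r - n = m * k
  · obtain ⟨k, hk⟩ := h
    have h2 : N - r = n + m * k := by linarith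
    rw [hk, h2, powEmb_coeff_mul, powEmb_coeff_mul, PowerSeries.coeff_mk]
    push_cast
    ring
  · push Not at h
    rw [powEmb_coeff_eq_zero _ _ h, powEmb_coeff_eq_zero _ _ h]
    simp

/-- Conjugating `d/dz` by `exp q`, where `q' = β z^(m/r - 1)`, gives `d/dz + q'`. On series `t ^ n
P(t ^ m)` this operator is `eulerStep` in the variable `x = t ^ m`, so a scalar equation for `y`
becomes an iterated `eulerStep` equation for `P`. -/
theorem zDeriv_powSeries_add (r : ℕ) (n : ℤ) (m : ℕ) [NeZero m] (β : ℂ) (P : ℂ⟦X⟧) :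
    zDeriv r (powSeries n m P) + powSeries n m P * HahnSeries.single ((r : ℤ) - m) β =
      powSeries (n + r - m) m (eulerStep β (-(n / r)) (m / r) P) := by
  rw [zDeriv_powSeries, eulerStep]
  simp only [powSeries, map_add, powEmb_X_mul, powEmb_smul, mul_add]
  rw [add_comm]
  congr 1
  · rw [mul_right_comm, ← mul_assoc, HahnSeries.single_mul_single, HahnSeries.single_mul_single]
    congr 3; ring
  · rw [← mul_assoc, HahnSeries.single_mul_single]
    congr 2 <;> ring_nf

/-! ### Power series solving the scalar equations -/

/-- The sequence with `p 0 = 1`, `p 1 = a` and `p (k + 2) = α k * p (k + 1) + β k * p k`. -/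
def linearRec (a : ℂ) (α β : ℕ → ℂ) : ℕ → ℂ
  | 0 => 1
  | 1 => a
  | (k + 2) => α k * linearRec a α β (k + 1) + β k * linearRec a α β k

/-- The constants `±1/4` come from the prefactor `z^(-1/4)`. They cancel in the sum of the two Euler
factors, which is `-3k`; hence the coefficient of `x` imposes nothing, and the coefficient of
`x^(k+2)` determines `p (k + 1)` from `p k` after division by `3γ(k + 1)`. -/
theorem exists_airy_series (γ : ℂ) (hγ : γ ≠ 0) :
    ∃ P : ℂ⟦X⟧, PowerSeries.coeff 0 P = 1 ∧
      eulerStep γ (1 / 4) (3 / 2) (eulerStep γ (-1 / 4) (3 / 2) P) = γ ^ 2 • P := by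
  let α : ℕ → ℂ := fun k =>
    (1 / 4 - 3 / 2 * (k + 1)) * (-1 / 4 - 3 / 2 * k) / (3 * γ * (k + 1))
  let p : ℕ → ℂ := fun k => linearRec (α 0) (fun k => α (k + 1)) 0 k
  have hp : ∀ k, p (k + 1) = α k * p k := by
    rintro (_ | k)
    · simp [p, linearRec]
    · simp [p, linearRec]
  refine ⟨PowerSeries.mk p, by simp [p, linearRec], ?_⟩
  ext k
  rw [PowerSeries.coeff_smul]
  rcases k with _ | _ | k
  · rw [coeff_zero_eulerStep, coeff_zero_eulerStep, smul_eq_mul]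
    ring
  · simp only [coeff_succ_eulerStep, coeff_zero_eulerStep, PowerSeries.coeff_mk, smul_eq_mul]
    push_cast
    ring
  · simp only [coeff_succ_eulerStep, PowerSeries.coeff_mk, smul_eq_mul]
    rw [hp (k + 1), hp k]
    simp only [α]
    have hk : (k : ℂ) + 1 ≠ 0 := by exact_mod_cast Nat.succ_ne_zero k
    push_cast
    field_simp
    ring

/-- As in the Airy case, the constants `-1/3, 0, 1/3` sum to zero, so the three Euler factors add up
to `-4k`. The coefficient of `x^(k+3)` is then a two-step recursion with leading factor `4β²(k +
2)`. -/
theorem exists_cubic_series (β : ℂ) (hβ : β ≠ 0) :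
    ∃ P : ℂ⟦X⟧, PowerSeries.coeff 0 P = 1 ∧
      eulerStep β (1 / 3) (4 / 3) (eulerStep β 0 (4 / 3) (eulerStep β (-1 / 3) (4 / 3) P)) =
        β ^ 3 • P := by
  let A : ℂ → ℂ := fun k => -1 / 3 - 4 / 3 * k
  let B : ℂ → ℂ := fun k => 0 - 4 / 3 * k
  let C : ℂ → ℂ := fun k => 1 / 3 - 4 / 3 * k
  -- The value of `p 1` is forced by the coefficient of `x²`: `4β² p 1 = β (B 1 * A 0 + C 1 * (A 0 +
  -- B 0)) = 7β/9`.
  let p : ℕ → ℂ := linearRec (7 / (36 * β))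
    (fun k => β * (B (k + 2) * A (k + 1) + C (k + 2) * (A (k + 1) + B (k + 1))) /
      (4 * β ^ 2 * (k + 2)))
    (fun k => C (k + 2) * B (k + 1) * A k / (4 * β ^ 2 * (k + 2)))
  have h0 : p 0 = 1 := by simp [p, linearRec]
  have h1 : p 1 = 7 / (36 * β) := by simp [p, linearRec]
  refine ⟨PowerSeries.mk p, by simp [h0], ?_⟩
  ext k
  rw [PowerSeries.coeff_smul]
  rcases k with _ | _ | _ | k
  · simp only [coeff_zero_eulerStep, smul_eq_mul]
    ring
  · simp only [coeff_succ_eulerStep, coeff_zero_eulerStep, PowerSeries.coeff_mk, smul_eq_mul]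
    push_cast
    ring
  · simp only [coeff_succ_eulerStep, coeff_zero_eulerStep, PowerSeries.coeff_mk, smul_eq_mul, h0, h1]
    push_cast
    norm_num
    field_simp
    ring
  · simp only [coeff_succ_eulerStep, PowerSeries.coeff_mk, smul_eq_mul]
    have hk : (k : ℂ) + 2 ≠ 0 := by exact_mod_cast Nat.succ_ne_zero (k + 1)
    have key : 4 * β ^ 2 * (k + 2) * p (k + 2) =
        β * (B (k + 2) * A (k + 1) + C (k + 2) * (A (k + 1) + B (k + 1))) * p (k + 1) +
        C (k + 2) * B (k + 1) * A k * p k := by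
      simp only [p, linearRec]
      field_simp
    simp only [A, B, C] at key
    push_cast
    linear_combination -key

theorem zDeriv_one (r : ℕ) : zDeriv r 1 = 0 := by
  rw [← HahnSeries.single_zero_one, zDeriv_single]
  simp

/-- One column of the gauge matrix, with `z = t^(-12)`: the entries are `y` and `y'` stripped of
`exp q`. The leading coefficients `1, γ` are recorded because they become a column of a Vandermonde
matrix. -/
theorem exists_airy_solution (γ c : ℂ) (hγ : γ ≠ 0) (hc : γ ^ 2 = c) :
    ∃ P₀ P₁ : ℂ⟦X⟧, PowerSeries.coeff 0 P₀ = 1 ∧ PowerSeries.coeff 0 P₁ = γ ∧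
      powSeries (-3) 18 P₁ - zDeriv 12 (powSeries 3 18 P₀) =
        powSeries 3 18 P₀ * HahnSeries.single (-6) γ ∧
      HahnSeries.single (-12) c * powSeries 3 18 P₀ - zDeriv 12 (powSeries (-3) 18 P₁) =
        powSeries (-3) 18 P₁ * HahnSeries.single (-6) γ := by
  obtain ⟨P, h0, hP⟩ := exists_airy_series γ hγ
  refine ⟨P, eulerStep γ (-1 / 4) (3 / 2) P, h0, by rw [coeff_zero_eulerStep, h0, mul_one], ?_, ?_⟩
  · have := zDeriv_powSeries_add 12 3 18 γ P
    norm_num at this ⊢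
    rw [← this]
    ring
  · have := zDeriv_powSeries_add 12 (-3) 18 γ (eulerStep γ (-1 / 4) (3 / 2) P)
    norm_num at this hP ⊢
    rw [hP, hc] at this
    rw [sub_eq_iff_eq_add', this, powSeries, powSeries, powEmb_smul, ← mul_assoc, ← mul_assoc,
      HahnSeries.single_mul_single, HahnSeries.single_mul_single]
    simp

/-- The analogous column `y, y', y''` for `y''' = b z y`; each derivative multiplies the leading
power by `t^(-4)`, that is, by `z^(1/3)`. -/
theorem exists_cubic_solution (β b : ℂ) (hβ : β ≠ 0) (hb : β ^ 3 = b) :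
    ∃ P₀ P₁ P₂ : ℂ⟦X⟧, PowerSeries.coeff 0 P₀ = 1 ∧ PowerSeries.coeff 0 P₁ = β ∧
      PowerSeries.coeff 0 P₂ = β ^ 2 ∧
      powSeries 0 16 P₁ - zDeriv 12 (powSeries 4 16 P₀) =
        powSeries 4 16 P₀ * HahnSeries.single (-4) β ∧
      powSeries (-4) 16 P₂ - zDeriv 12 (powSeries 0 16 P₁) =
        powSeries 0 16 P₁ * HahnSeries.single (-4) β ∧
      HahnSeries.single (-12) b * powSeries 4 16 P₀ - zDeriv 12 (powSeries (-4) 16 P₂) =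
        powSeries (-4) 16 P₂ * HahnSeries.single (-4) β := by
  obtain ⟨P, h0, hP⟩ := exists_cubic_series β hβ
  refine ⟨P, eulerStep β (-1 / 3) (4 / 3) P,
    eulerStep β 0 (4 / 3) (eulerStep β (-1 / 3) (4 / 3) P), h0, ?_, ?_, ?_, ?_, ?_⟩
  · rw [coeff_zero_eulerStep, h0, mul_one]
  · rw [coeff_zero_eulerStep, coeff_zero_eulerStep, h0, mul_one, sq]
  · have := zDeriv_powSeries_add 12 4 16 β P
    norm_num at this ⊢
    rw [← this]
    ring
  · have := zDeriv_powSeries_add 12 0 16 β (eulerStep β (-1 / 3) (4 / 3) P)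
    norm_num at this ⊢
    rw [← this]
    ring
  · have := zDeriv_powSeries_add 12 (-4) 16 β
      (eulerStep β 0 (4 / 3) (eulerStep β (-1 / 3) (4 / 3) P))
    norm_num at this hP ⊢
    rw [hP, hb] at this
    rw [sub_eq_iff_eq_add', this, powSeries, powSeries, powEmb_smul, ← mul_assoc, ← mul_assoc,
      HahnSeries.single_mul_single, HahnSeries.single_mul_single]
    simp

/-! ### Invertibility of the gauge blocks -/

/-- The constant term of `M.det` is the determinant of the constant terms, so `M.det` is nonzero; it
stays nonzero under the injective map `powEmb m`. -/
theorem powEmb_mulVec_injective {n : Type*} [Fintype n] [DecidableEq n] (m : ℕ) [NeZero m]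
    (M : Matrix n n ℂ⟦X⟧) (hM : (M.map (PowerSeries.constantCoeff (R := ℂ))).det ≠ 0)
    (x : n → LaurentSeries ℂ) (hx : ∀ i, ∑ j, powEmb m (M i j) * x j = 0) : x = 0 := by
  have h1 : M.det ≠ 0 := by
    intro h
    apply hM
    have := RingHom.map_det (PowerSeries.constantCoeff (R := ℂ)) M
    rw [h, map_zero] at this
    exact this.symm
  have h2 : (M.map (powEmb m)).det ≠ 0 := by
    have := RingHom.map_det (powEmb m) M
    rw [RingHom.mapMatrix_apply] at this
    rw [← this]
    exact fun h => h1 (powEmb_injective m (h.trans (map_zero _).symm))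
  exact Matrix.eq_zero_of_mulVec_eq_zero h2 (funext hx)

theorem powSeries_mulVec_injective {n : Type*} [Fintype n] [DecidableEq n] (m : ℕ) [NeZero m]
    (e : n → ℤ) (M : Matrix n n ℂ⟦X⟧)
    (hM : (M.map (PowerSeries.constantCoeff (R := ℂ))).det ≠ 0)
    (x : n → LaurentSeries ℂ) (hx : ∀ i, ∑ j, powSeries (e i) m (M i j) * x j = 0) : x = 0 := by
  refine powEmb_mulVec_injective m M hM x fun i => ?_
  have h := hx i
  simp only [powSeries, mul_assoc, ← Finset.mul_sum] at h
  exact (mul_eq_zero.1 h).resolve_left (by simp)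

/-! ### The normal form of the example -/

theorem toLaurent_mono (r : ℕ) (a : ℂ) (k : ℚ) (hk : 0 < k) :
    (mono a k hk).toLaurent r = HahnSeries.single (-(numer r k : ℤ)) a := by
  simp [mono, ExpFactor.toLaurent]

theorem ram_mono {a : ℂ} (ha : a ≠ 0) (k : ℚ) (hk : 0 < k) : ram (mono a k hk) = k.den := by
  unfold ram mono
  rw [Finsupp.support_single _ ha]
  simp

theorem ram_mono_dvd (a : ℂ) (k : ℚ) (hk : 0 < k) : ram (mono a k hk) ∣ k.den := by
  by_cases ha : a = 0
  · simp [ram, mono, ha]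
  · rw [ram_mono ha]

/-- The exponential factors of `exampleMatrix a b c`, where `β` and `γ` list the cube roots of `b`
and the square roots of `c`. -/
def exampleFactors (a : ℂ) (β : Fin 3 → ℂ) (γ : Fin 2 → ℂ) : Fin 6 → ExpFactor :=
  ![mono (a / 3) 3 (by norm_num), mono (3 / 4 * β 0) (4 / 3) (by norm_num),
    mono (3 / 4 * β 1) (4 / 3) (by norm_num), mono (3 / 4 * β 2) (4 / 3) (by norm_num),
    mono (2 / 3 * γ 0) (3 / 2) (by norm_num), mono (2 / 3 * γ 1) (3 / 2) (by norm_num)]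

theorem hasNormalForm_exampleMatrix (a b c : ℂ) (β : Fin 3 → ℂ) (γ : Fin 2 → ℂ)
    (hβ0 : ∀ j, β j ≠ 0) (hβ : ∀ j, β j ^ 3 = b) (hβi : Function.Injective β)
    (hγ0 : ∀ j, γ j ≠ 0) (hγ : ∀ j, γ j ^ 2 = c) (hγi : Function.Injective γ) :
    HasNormalForm (exampleMatrix a b c) (exampleFactors a β γ) := by
  choose P₀ P₁ P₂ hP₀ hP₁ hP₂ hu₀ hu₁ hu₂ using
    fun j => exists_cubic_solution (β j) b (hβ0 j) (hβ j)
  choose R₀ R₁ hR₀ hR₁ hv₀ hv₁ using fun j => exists_airy_solution (γ j) c (hγ0 j) (hγ j)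
  let G : Matrix (Fin 6) (Fin 6) (LaurentSeries ℂ) :=
    !![1, 0, 0, 0, 0, 0;
       0, powSeries 4 16 (P₀ 0), powSeries 4 16 (P₀ 1), powSeries 4 16 (P₀ 2), 0, 0;
       0, powSeries 0 16 (P₁ 0), powSeries 0 16 (P₁ 1), powSeries 0 16 (P₁ 2), 0, 0;
       0, powSeries (-4) 16 (P₂ 0), powSeries (-4) 16 (P₂ 1), powSeries (-4) 16 (P₂ 2), 0, 0;
       0, 0, 0, 0, powSeries 3 18 (R₀ 0), powSeries 3 18 (R₀ 1);
       0, 0, 0, 0, powSeries (-3) 18 (R₁ 0), powSeries (-3) 18 (R₁ 1)]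
  have hD : (fun i => zDeriv 12 ((exampleFactors a β γ i).toLaurent 12)) =
      ![HahnSeries.single (-24) a, HahnSeries.single (-4) (β 0), HahnSeries.single (-4) (β 1),
        HahnSeries.single (-4) (β 2), HahnSeries.single (-6) (γ 0),
        HahnSeries.single (-6) (γ 1)] := by
    have h1 : numer 12 3 = 36 := by rw [numer]; norm_num
    have h2 : numer 12 (4 / 3) = 16 := by rw [numer]; norm_num
    have h3 : numer 12 (3 / 2) = 18 := by rw [numer]; norm_num
    funext i
    fin_cases i <;>
      simp only [exampleFactors, toLaurent_mono, zDeriv_single, h1, h2, h3, Fin.reduceFinMk,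
        Matrix.cons_val, Fin.zero_eta, Fin.mk_one, Matrix.cons_val_zero, Matrix.cons_val_one] <;>
      congr 1 <;> push_cast <;> ring
  -- The ramification orders 1, 3, 2 only need `6 ∣ r`. Taking `r = 12` makes `z^(-1/4) = t^3` a
  -- Laurent monomial as well, so all prefactors are absorbed in `G` and `Λ = 0`.
  refine ⟨12, G, 0, by norm_num, ?_, ?_, by simp, ?_⟩
  · have h1 : (3 : ℚ).den ∣ 12 := by norm_num
    have h2 : (4 / 3 : ℚ).den ∣ 12 := by
      have : (4 / 3 : ℚ).den = 3 := by norm_num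
      rw [this]; norm_num
    have h3 : (3 / 2 : ℚ).den ∣ 12 := by
      have : (3 / 2 : ℚ).den = 2 := by norm_num
      rw [this]; norm_num
    intro i
    fin_cases i
    exacts [(ram_mono_dvd _ _ _).trans h1, (ram_mono_dvd _ _ _).trans h2,
      (ram_mono_dvd _ _ _).trans h2, (ram_mono_dvd _ _ _).trans h2,
      (ram_mono_dvd _ _ _).trans h3, (ram_mono_dvd _ _ _).trans h3]
  · rw [← Matrix.mulVec_injective_iff_isUnit]
    change Function.Injective (Matrix.mulVecLin G)
    rw [injective_iff_map_eq_zero]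
    intro x hx
    have hx' : ∀ i, ∑ j, G i j * x j = 0 := fun i => congrFun hx i
    have h₀ : x 0 = 0 := by simpa [Fin.sum_univ_succ, G] using hx' 0
    have hc := powSeries_mulVec_injective 16 ![4, 0, -4] (Matrix.of ![P₀, P₁, P₂])
      (by
        have : (Matrix.of ![P₀, P₁, P₂]).map (PowerSeries.constantCoeff (R := ℂ)) =
            (Matrix.vandermonde β).transpose := by
          ext i j
          fin_cases i
          · simpa using hP₀ j
          · simpa using hP₁ j
          · simpa using hP₂ j
        rw [this, Matrix.det_transpose]
        exact Matrix.det_vandermonde_ne_zero_iff.2 hβi)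
      ![x 1, x 2, x 3]
      (by
        intro i
        fin_cases i
        · simpa [Fin.sum_univ_succ, G] using hx' 1
        · simpa [Fin.sum_univ_succ, G] using hx' 2
        · simpa [Fin.sum_univ_succ, G] using hx' 3)
    have ha := powSeries_mulVec_injective 18 ![3, -3] (Matrix.of ![R₀, R₁])
      (by
        have : (Matrix.of ![R₀, R₁]).map (PowerSeries.constantCoeff (R := ℂ)) =
            (Matrix.vandermonde γ).transpose := by
          ext i j
          fin_cases i
          · simpa using hR₀ j
          · simpa using hR₁ j
        rw [this, Matrix.det_transpose]
        exact Matrix.det_vandermonde_ne_zero_iff.2 hγi)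
      ![x 4, x 5]
      (by
        intro i
        fin_cases i
        · simpa [Fin.sum_univ_succ, G] using hx' 4
        · simpa [Fin.sum_univ_succ, G] using hx' 5)
    funext i
    fin_cases i
    exacts [h₀, congrFun hc 0, congrFun hc 1, congrFun hc 2, congrFun ha 0, congrFun ha 1]
  · rw [hD]
    have hX : polyToLaurent 12 Polynomial.X = HahnSeries.single (-12) 1 := by
      simp [polyToLaurent]
    have hC : ∀ y, polyToLaurent 12 (Polynomial.C y) = HahnSeries.single 0 y := by
      intro y
      rw [polyToLaurent, Polynomial.aeval_C, HahnSeries.algebraMap_apply']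
      exact HahnSeries.ofPowerSeries_C y
    have hz : (0 : Matrix (Fin 6) (Fin 6) ℂ).map
        (fun a => (HahnSeries.single ((12 : ℕ) : ℤ) a : LaurentSeries ℂ)) = 0 := by
      ext1 i j
      simp
    rw [hz, add_zero]
    ext1 i j
    rw [Matrix.mul_diagonal]
    have h2 : ∀ y : ℂ, HahnSeries.single 0 y * HahnSeries.single (-12) (1 : ℂ) =
      HahnSeries.single (-12) y := by
      intro y
      rw [HahnSeries.single_mul_single]
      norm_num
    -- Entrywise, the blocks off the diagonal are trivial, the rank one block is `zDeriv_one`, and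
    -- the rest are the column equations `hu₀`, `hu₁`, `hu₂`, `hv₀`, `hv₁`. Products with `single 0
    -- y` must not be rewritten as scalar multiples, or `h2` would no longer apply.
    fin_cases i <;> fin_cases j <;>
      simp [Matrix.mul_apply, Fin.sum_univ_succ, G, exampleMatrix, hX, hC, h2, zDeriv_one, hu₀,
        hu₁, hu₂, hv₀, hv₁, -HahnSeries.single_zero_mul_eq_smul]

/-! ### The irregular class of the example -/

theorem circ_eq_circ {q q' : ExpFactor} : circ q = circ q' ↔ GaloisConj q q' := Quotient.eq

theorem circ_mono_ne {a a' : ℂ} {k k' : ℚ} (hk : 0 < k) (hk' : 0 < k') (ha : a ≠ 0)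
    (hkk : k ≠ k') : circ (mono a k hk) ≠ circ (mono a' k' hk') := by
  intro h
  obtain ⟨n, hn⟩ := circ_eq_circ.1 h.symm
  have := hn ⟨k, hk⟩
  rw [mono, mono, Finsupp.single_eq_same, Finsupp.single_eq_of_ne (by simpa using hkk), mul_zero]
    at this
  exact ha this

theorem isPrimitiveRoot_exp (k : ℚ) :
    IsPrimitiveRoot (Complex.exp (2 * Real.pi * Complex.I * ((k : ℚ) : ℂ))) k.den := by
  have hd : ((k.den : ℕ) : ℂ) ≠ 0 := by exact_mod_cast k.den_nz
  have h := (Complex.isPrimitiveRoot_exp k.den k.den_nz).zpow_of_gcd_eq_one k.num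
    k.reduced
  rw [← Complex.exp_int_mul] at h
  have hk : (k : ℂ) = k.num / k.den := Rat.cast_def k
  have he : 2 * Real.pi * Complex.I * (k : ℂ) = k.num * (2 * Real.pi * Complex.I / k.den) := by
    rw [hk]
    field_simp
  rw [he]
  exact h

/-- Going once around infinity multiplies `z ^ k` by a primitive root of unity of order `k.den`, so
the number of turns matters only modulo `k.den`. -/
theorem circ_eq_circ_mono {p : ExpFactor} {a : ℂ} {k : ℚ} (hk : 0 < k) :
    circ p = circ (mono a k hk) ↔ ∃ j < k.den,
      p = mono (Complex.exp (2 * Real.pi * Complex.I * ((k : ℚ) : ℂ)) ^ j * a) k hk := by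
  have hζ := isPrimitiveRoot_exp k
  set ζ := Complex.exp (2 * Real.pi * Complex.I * ((k : ℚ) : ℂ)) with hζdef
  have hz : ∀ n : ℤ, Complex.exp (2 * Real.pi * Complex.I * n * ((k : ℚ) : ℂ)) = ζ ^ n := by
    intro n
    rw [hζdef, ← Complex.exp_int_mul]
    congr 1
    ring
  rw [eq_comm, circ_eq_circ]
  constructor
  · rintro ⟨n, hn⟩
    have hd : (0 : ℤ) < k.den := by exact_mod_cast k.den_pos
    refine ⟨(n % k.den).toNat, ?_, ?_⟩
    · have := Int.emod_lt_of_pos n hd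
      have := Int.emod_nonneg n hd.ne'
      omega
    · have h : ζ ^ (n % k.den).toNat = ζ ^ n := by
        rw [← zpow_natCast, Int.toNat_of_nonneg (Int.emod_nonneg n hd.ne'), Int.emod_def,
          zpow_sub₀ (hζ.ne_zero k.den_nz), zpow_mul, zpow_natCast, hζ.pow_eq_one]
        simp
      ext l
      rw [hn l, h]
      by_cases hl : l = ⟨k, hk⟩
      · subst hl
        simp only [mono, Finsupp.single_eq_same]
        rw [hz]
      · simp [mono, Finsupp.single_eq_of_ne hl]
  · rintro ⟨j, -, rfl⟩
    refine ⟨j, fun l => ?_⟩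
    by_cases hl : l = ⟨k, hk⟩
    · subst hl
      simp only [mono, Finsupp.single_eq_same]
      rw [hz, zpow_natCast]
    · simp [mono, Finsupp.single_eq_of_ne hl]

theorem matrix_ofMatrix {n : ℕ} (A : Matrix (Fin n) (Fin n) ℂ[X]) :
    (AlgConnection.ofMatrix A).matrix (Pi.basisFun ℂ[X] (Fin n)) = A := by
  ext1 i j
  have hb : (Pi.basisFun ℂ[X] (Fin n)) j = (Pi.single j 1 : Fin n → ℂ[X]) :=
    Pi.basisFun_apply _ _ _
  change -((fun i => Polynomial.derivative (Pi.basisFun ℂ[X] (Fin n) j i)) -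
    A.mulVec (Pi.basisFun ℂ[X] (Fin n) j)) i = A i j
  rw [hb]
  change -(Polynomial.derivative ((Pi.single j 1 : Fin n → ℂ[X]) i) -
    A.mulVec (Pi.single j 1) i) = A i j
  rw [Matrix.mulVec_single_one]
  by_cases h : i = j
  · subst h; simp
  · simp [h]

open Classical in
-- When neither the factors nor the circles repeat, both counts are 0 or 1, and it is enough to
-- compare the set of factors with the union of the circles.
theorem card_fiber_eq_count {n : ℕ} (q : Fin n → ExpFactor) (Θ : IrregularClass)
    (hq : Function.Injective q) (hΘ : Θ.Nodup)
    (h : ∀ p, circ p ∈ Θ ↔ p ∈ Set.range q) (p : ExpFactor) :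
    Nat.card {i : Fin n // q i = p} = Multiset.count (circ p) Θ := by
  rw [Multiset.count_eq_of_nodup hΘ]
  by_cases hp : p ∈ Set.range q
  · rw [if_pos ((h p).2 hp)]
    obtain ⟨i, rfl⟩ := hp
    rw [Nat.card_eq_one_iff_unique]
    exact ⟨⟨fun x y => Subtype.ext (hq (x.2.trans y.2.symm))⟩, ⟨⟨i, rfl⟩⟩⟩
  · rw [if_neg (mt (h p).1 hp)]
    have : IsEmpty {i : Fin n // q i = p} := ⟨fun x => hp ⟨x.1, x.2⟩⟩
    exact Nat.card_of_isEmpty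

theorem mono_inj {a a' : ℂ} {k k' : ℚ} {hk : 0 < k} {hk' : 0 < k'} (ha : a ≠ 0) :
    mono a k hk = mono a' k' hk' ↔ k = k' ∧ a = a' := by
  simp [mono, Finsupp.single_eq_single_iff, ha]

theorem hasIrregularClass_exampleMatrix (a β γ : ℂ) (ha : a ≠ 0) (hβ : β ≠ 0) (hγ : γ ≠ 0) :
    (AlgConnection.ofMatrix (exampleMatrix a (β ^ 3) (γ ^ 2))).HasIrregularClass
      {circ (mono (a / 3) 3 (by norm_num)), circ (mono (3 / 4 * β) (4 / 3) (by norm_num)),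
        circ (mono (2 / 3 * γ) (3 / 2) (by norm_num))} := by
  have hd1 : (3 : ℚ).den = 1 := rfl
  have hd2 : (4 / 3 : ℚ).den = 3 := by norm_num
  have hd3 : (3 / 2 : ℚ).den = 2 := by norm_num
  have hζ := isPrimitiveRoot_exp (4 / 3)
  have hη := isPrimitiveRoot_exp (3 / 2)
  rw [hd2] at hζ
  rw [hd3] at hη
  have e1 : ∀ p, circ p = circ (mono (a / 3) 3 (by norm_num)) ↔ p = mono (a / 3) 3 (by norm_num) := by
    intro p
    rw [circ_eq_circ_mono, hd1]
    simp
  have e2 := fun p => @circ_eq_circ_mono p (3 / 4 * β) (4 / 3) (by norm_num)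
  have e3 := fun p => @circ_eq_circ_mono p (2 / 3 * γ) (3 / 2) (by norm_num)
  rw [hd2] at e2
  rw [hd3] at e3
  generalize Complex.exp (2 * Real.pi * Complex.I * ((4 / 3 : ℚ) : ℂ)) = ζ at hζ e2
  generalize Complex.exp (2 * Real.pi * Complex.I * ((3 / 2 : ℚ) : ℂ)) = η at hη e3
  have hζ0 : ζ ≠ 0 := hζ.ne_zero (by norm_num)
  have hη0 : η ≠ 0 := hη.ne_zero (by norm_num)
  -- Listing the roots as `ζ ^ j β` makes the exponential factors run through the Galois orbit in
  -- the order of `e2`; likewise for `γs` and `e3`.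
  let βs : Fin 3 → ℂ := fun j => ζ ^ (j : ℕ) * β
  let γs : Fin 2 → ℂ := fun j => η ^ (j : ℕ) * γ
  have hβs0 : ∀ j, βs j ≠ 0 := fun j => mul_ne_zero (pow_ne_zero _ hζ0) hβ
  have hγs0 : ∀ j, γs j ≠ 0 := fun j => mul_ne_zero (pow_ne_zero _ hη0) hγ
  have hβi : Function.Injective βs := fun i j h =>
    Fin.ext (hζ.pow_inj i.2 j.2 (mul_right_cancel₀ hβ h))
  have hγi : Function.Injective γs := fun i j h =>
    Fin.ext (hη.pow_inj i.2 j.2 (mul_right_cancel₀ hγ h))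
  refine ⟨6, Pi.basisFun ℂ[X] (Fin 6), exampleFactors a βs γs, ?_,
    card_fiber_eq_count _ _ ?_ ?_ ?_⟩
  · rw [matrix_ofMatrix]
    refine hasNormalForm_exampleMatrix a _ _ βs γs hβs0 (fun j => ?_) hβi hγs0 (fun j => ?_) hγi
    · rw [mul_pow, pow_right_comm, hζ.pow_eq_one, one_pow, one_mul]
    · rw [mul_pow, pow_right_comm, hη.pow_eq_one, one_pow, one_mul]
  · have k1 : (3 : ℚ) ≠ 4 / 3 := by norm_num
    have k2 : (3 : ℚ) ≠ 3 / 2 := by norm_num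
    have k3 : (4 / 3 : ℚ) ≠ 3 / 2 := by norm_num
    have f1 : βs 0 ≠ βs 1 := hβi.ne (by decide)
    have f2 : βs 0 ≠ βs 2 := hβi.ne (by decide)
    have f3 : βs 1 ≠ βs 2 := hβi.ne (by decide)
    have f4 : γs 0 ≠ γs 1 := hγi.ne (by decide)
    intro i j h
    fin_cases i <;> fin_cases j <;>
      simp [exampleFactors, mono_inj, ha, hβs0, hγs0, k1, k2, k3, k1.symm, k2.symm, k3.symm, f1, f2,
        f3, f4, f1.symm, f2.symm, f3.symm, f4.symm] at h ⊢
  · have n1 : a / 3 ≠ 0 := div_ne_zero ha (by norm_num)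
    have n2 : 3 / 4 * β ≠ 0 := mul_ne_zero (by norm_num) hβ
    simp only [Multiset.insert_eq_cons, Multiset.nodup_cons, Multiset.mem_cons,
      Multiset.mem_singleton, not_or, Multiset.nodup_singleton, and_true]
    exact ⟨⟨circ_mono_ne _ _ n1 (by norm_num), circ_mono_ne _ _ n1 (by norm_num)⟩,
      circ_mono_ne _ _ n2 (by norm_num)⟩
  · intro p
    have g2 : ∀ j : ℕ, ζ ^ j * (3 / 4 * β) = 3 / 4 * (ζ ^ j * β) := fun j => by ring
    have g3 : ∀ j : ℕ, η ^ j * (2 / 3 * γ) = 2 / 3 * (η ^ j * γ) := fun j => by ring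
    simp only [Multiset.insert_eq_cons, Multiset.mem_cons, Multiset.mem_singleton, e1, e2, e3, g2, g3]
    constructor
    · rintro (rfl | ⟨j, hj, rfl⟩ | ⟨j, hj, rfl⟩)
      · exact ⟨0, rfl⟩
      · interval_cases j
        exacts [⟨1, rfl⟩, ⟨2, rfl⟩, ⟨3, rfl⟩]
      · interval_cases j
        exacts [⟨4, rfl⟩, ⟨5, rfl⟩]
    · rintro ⟨i, rfl⟩
      fin_cases i
      · exact Or.inl rfl
      · exact Or.inr (Or.inl ⟨0, by norm_num, rfl⟩)
      · exact Or.inr (Or.inl ⟨1, by norm_num, rfl⟩)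
      · exact Or.inr (Or.inl ⟨2, by norm_num, rfl⟩)
      · exact Or.inr (Or.inr ⟨0, by norm_num, rfl⟩)
      · exact Or.inr (Or.inr ⟨1, by norm_num, rfl⟩)

/-! ### The core diagram of the example -/

theorem gcdOf_empty (r : ℕ) : gcdOf r ∅ = r := by simp [gcdOf]

theorem slope_mono {a : ℂ} (ha : a ≠ 0) (k : ℚ) (hk : 0 < k) : slope (mono a k hk) = k := by
  unfold slope mono
  rw [Finsupp.support_single _ ha, Finset.sup_singleton, Rat.coe_toNNRat _ hk.le]

theorem trunc_mono_of_le {a : ℂ} {k c : ℚ} (hk : 0 < k) (h : c ≤ k) :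
    trunc c (mono a k hk) = mono a k hk :=
  Finsupp.filter_single_of_pos _ h

theorem trunc_mono_of_lt {a : ℂ} {k c : ℚ} (hk : 0 < k) (h : k < c) :
    trunc c (mono a k hk) = 0 :=
  Finsupp.filter_single_of_neg _ (not_le.2 h)

theorem circ_mono_ne_zero {a : ℂ} (ha : a ≠ 0) {k : ℚ} (hk : 0 < k) :
    circ (mono a k hk) ≠ circ 0 := by
  intro h
  obtain ⟨n, hn⟩ := circ_eq_circ.1 h.symm
  have := hn ⟨k, hk⟩
  simp [mono, ha] at this

/-- The infimum defining `cutoff` is attained, since a cutoff above all exponents makes both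
truncations zero. This property alone, without the value of the cutoff, determines the common part
of two monomials of distinct slopes. -/
theorem circ_trunc_cutoff (q q' : ExpFactor) :
    circ (trunc (cutoff q q') q) = circ (trunc (cutoff q q') q') := by
  have hr : 0 < Nat.lcm (ram q) (ram q') :=
    Nat.lcm_pos (ram_isLeast q).1.1 (ram_isLeast q').1.1
  have hr' : (0 : ℚ) < (Nat.lcm (ram q) (ram q') : ℚ) := by exact_mod_cast hr
  have hne : {m : ℕ | 0 < m ∧
      circ (trunc ((m : ℚ) / (Nat.lcm (ram q) (ram q') : ℚ)) q) =
        circ (trunc ((m : ℚ) / (Nat.lcm (ram q) (ram q') : ℚ)) q')}.Nonempty := by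
    -- The sum of all exponents serves as an upper bound for each of them.
    obtain ⟨m, hm⟩ := exists_nat_gt
      ((∑ k ∈ q.support ∪ q'.support, (k : ℚ)) * (Nat.lcm (ram q) (ram q') : ℚ))
    have hb : ∀ k ∈ q.support ∪ q'.support, (k : ℚ) < m / (Nat.lcm (ram q) (ram q') : ℚ) := by
      intro k hk
      rw [lt_div_iff₀ hr']
      refine lt_of_le_of_lt (mul_le_mul_of_nonneg_right ?_ hr'.le) hm
      exact Finset.single_le_sum (f := fun k : Exponent => (k : ℚ)) (fun l _ => l.2.le) hk
    have hz : ∀ p : ExpFactor, p.support ⊆ q.support ∪ q'.support →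
        trunc (m / (Nat.lcm (ram q) (ram q') : ℚ)) p = 0 := by
      intro p hp
      ext k
      by_cases hk : k ∈ p.support
      · simp [trunc, (hb k (hp hk)).not_ge]
      · simp [trunc, Finsupp.filter_apply, Finsupp.notMem_support_iff.1 hk]
    refine ⟨m, ?_, ?_⟩
    · have h0 : (0 : ℚ) ≤ (∑ k ∈ q.support ∪ q'.support, (k : ℚ)) *
          (Nat.lcm (ram q) (ram q') : ℚ) :=
        mul_nonneg (Finset.sum_nonneg fun l _ => l.2.le) hr'.le
      exact_mod_cast h0.trans_lt hm
    · rw [hz q Finset.subset_union_left, hz q' Finset.subset_union_right]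
  exact (Nat.sInf_mem hne).2

theorem commonPart_mono {a a' : ℂ} {k k' : ℚ} (hk : 0 < k) (hk' : 0 < k') (ha : a ≠ 0)
    (hkk : k ≠ k') : commonPart (mono a k hk) (mono a' k' hk') = 0 := by
  have h := circ_trunc_cutoff (mono a k hk) (mono a' k' hk')
  unfold commonPart
  generalize cutoff (mono a k hk) (mono a' k' hk') = c at *
  rcases le_or_gt c k with h1 | h1
  · exfalso
    rw [trunc_mono_of_le hk h1] at h
    rcases le_or_gt c k' with h2 | h2
    · rw [trunc_mono_of_le hk' h2] at h
      exact circ_mono_ne hk hk' ha hkk h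
    · rw [trunc_mono_of_lt hk' h2] at h
      exact circ_mono_ne_zero ha hk h
  · exact trunc_mono_of_lt hk h1

/-- With zero common part the level sum is empty, the gcd is the full ramification order of the
second circle, and the fission exponent is `k`. -/
theorem edgeFormula_mono {a a' : ℂ} {k k' : ℚ} (hk : 0 < k) (hk' : 0 < k') (ha : a ≠ 0)
    (ha' : a' ≠ 0) (hkk : k ≠ k') :
    edgeFormula (mono a k hk) (mono a' k' hk') =
      numer k.den k * (k'.den : ℤ) - k.den * k'.den := by
  simp [edgeFormula, diffPart, commonPart_mono hk hk' ha hkk, ram_mono ha, ram_mono ha',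
    slope_mono ha, levelSum, gcdOf_empty]

theorem mult_mono_of_gt {a a' : ℂ} {k k' : ℚ} (hk : 0 < k) (hk' : 0 < k') (ha : a ≠ 0)
    (ha' : a' ≠ 0) (hkk : k' < k) :
    (circ (mono a k hk)).mult (circ (mono a' k' hk')) =
      numer k.den k * (k'.den : ℤ) - k.den * k'.den := by
  rw [StokesCircle.mult, if_neg (circ_mono_ne hk hk' ha hkk.ne')]
  change edgeMult _ _ = _
  rw [edgeMult, if_pos, edgeFormula_mono hk hk' ha ha' hkk.ne']
  simp [diffPart, commonPart_mono, ha, ha', hkk.ne, hkk.ne', slope_mono, hkk.le]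

theorem mult_mono_of_lt {a a' : ℂ} {k k' : ℚ} (hk : 0 < k) (hk' : 0 < k') (ha : a ≠ 0)
    (ha' : a' ≠ 0) (hkk : k' < k) :
    (circ (mono a' k' hk')).mult (circ (mono a k hk)) =
      numer k.den k * (k'.den : ℤ) - k.den * k'.den := by
  rw [StokesCircle.mult, if_neg (circ_mono_ne hk hk' ha hkk.ne').symm]
  change edgeMult _ _ = _
  rw [edgeMult, if_neg, edgeFormula_mono hk hk' ha ha' hkk.ne']
  simp [diffPart, commonPart_mono, ha, ha', hkk.ne, hkk.ne', slope_mono, hkk]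

theorem mult_self_mono {a : ℂ} {k : ℚ} (hk : 0 < k) (ha : a ≠ 0) :
    (circ (mono a k hk)).mult (circ (mono a k hk)) =
      numer k.den k * ((k.den : ℤ) - (Nat.gcd k.den (numer k.den k) : ℤ)) - (k.den : ℤ) ^ 2 + 1 := by
  rw [StokesCircle.mult, if_pos rfl]
  change loopMult _ = _
  rw [loopMult, ram_mono ha, mono, Finsupp.support_single _ ha, levelSum, Finset.sum_singleton]
  simp [Finset.filter_singleton, gcdOf]

theorem mult_example {a b c : ℂ} (ha : a ≠ 0) (hb : b ≠ 0) (hc : c ≠ 0) (I J K : StokesCircle)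
    (hI : I = circ (mono a 3 (by norm_num))) (hJ : J = circ (mono b (4 / 3) (by norm_num)))
    (hK : K = circ (mono c (3 / 2) (by norm_num))) :
    (I ≠ J ∧ I ≠ K ∧ J ≠ K) ∧ (I.mult I = 0 ∧ J.mult J = 0 ∧ K.mult K = 0) ∧
      (I.mult J = 6 ∧ J.mult K = 3 ∧ K.mult I = 4) ∧
      (J.mult I = 6 ∧ K.mult J = 3 ∧ I.mult K = 4) := by
  have hd1 : (3 : ℚ).den = 1 := rfl
  have hd2 : (4 / 3 : ℚ).den = 3 := by norm_num
  have hd3 : (3 / 2 : ℚ).den = 2 := by norm_num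
  have h1 : numer 1 3 = 3 := by rw [numer]; norm_num
  have h2 : numer 3 (4 / 3) = 4 := by rw [numer]; norm_num
  have h3 : numer 2 (3 / 2) = 3 := by rw [numer]; norm_num
  subst hI hJ hK
  refine ⟨⟨circ_mono_ne _ _ ha (by norm_num), circ_mono_ne _ _ ha (by norm_num),
    circ_mono_ne _ _ hb (by norm_num)⟩, ⟨?_, ?_, ?_⟩, ⟨?_, ?_, ?_⟩, ?_, ?_, ?_⟩
  · rw [mult_self_mono _ ha, hd1, h1]; norm_num
  · rw [mult_self_mono _ hb, hd2, h2]; norm_num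
  · rw [mult_self_mono _ hc, hd3, h3]; norm_num
  · rw [mult_mono_of_gt _ _ ha hb (by norm_num), hd1, hd2, h1]; norm_num
  · rw [mult_mono_of_lt _ _ hc hb (by norm_num), hd2, hd3, h3]; norm_num
  · rw [mult_mono_of_lt _ _ ha hc (by norm_num), hd1, hd3, h1]; norm_num
  · rw [mult_mono_of_lt _ _ ha hb (by norm_num), hd1, hd2, h1]; norm_num
  · rw [mult_mono_of_gt _ _ hc hb (by norm_num), hd2, hd3, h3]; norm_num
  · rw [mult_mono_of_gt _ _ ha hc (by norm_num), hd1, hd3, h1]; norm_num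

theorem isCoreDiagramOf_triangle346 {a b c : ℂ} (ha : a ≠ 0) (hb : b ≠ 0) (hc : c ≠ 0) :
    triangle346.IsCoreDiagramOf {circ (mono a 3 (by norm_num)),
      circ (mono b (4 / 3) (by norm_num)), circ (mono c (3 / 2) (by norm_num))} := by
  obtain ⟨⟨n1, n2, n3⟩, ⟨l1, l2, l3⟩, ⟨m1, m2, m3⟩, m4, m5, m6⟩ :=
    mult_example ha hb hc _ _ _ rfl rfl rfl
  generalize circ (mono a 3 (by norm_num)) = I at *
  generalize circ (mono b (4 / 3) (by norm_num)) = J at *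
  generalize circ (mono c (3 / 2) (by norm_num)) = K at *
  let f : Fin 3 → {L : StokesCircle // L ∈ ({I, J, K} : Multiset StokesCircle)} :=
    ![⟨I, by simp⟩, ⟨J, by simp⟩, ⟨K, by simp⟩]
  have hf : Function.Bijective f := by
    constructor
    · intro i j h
      fin_cases i <;> fin_cases j <;> simp [f, n1, n2, n3, n1.symm, n2.symm, n3.symm] at h ⊢
    · rintro ⟨L, hL⟩
      have hL' : L = I ∨ L = J ∨ L = K := by simpa using hL
      rcases hL' with rfl | rfl | rfl
      exacts [⟨0, rfl⟩, ⟨1, rfl⟩, ⟨2, rfl⟩]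
  refine ⟨Equiv.ofBijective f hf, fun i j => ?_⟩
  change triangle346.B i j = StokesCircle.mult (f i) (f j)
  change Fin 3 at i j
  fin_cases i <;> fin_cases j
  exacts [l1.symm, m1.symm, m6.symm, m4.symm, l2.symm, m2.symm, m3.symm, m5.symm, l3.symm]

/-! ### Untwisted irregular classes have ultrametric core diagrams -/

theorem le_slope {q : ExpFactor} {k : Exponent} (hk : q k ≠ 0) : (k : ℚ) ≤ slope q := by
  have h := Finset.le_sup (f := fun k : Exponent => (k : ℚ).toNNRat) (Finsupp.mem_support_iff.2 hk)
  have h' : (((k : ℚ).toNNRat : NNRat) : ℚ) ≤ slope q := NNRat.coe_le_coe.2 h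
  rwa [Rat.coe_toNNRat _ k.2.le] at h'

theorem slope_le {q : ExpFactor} {c : ℚ} (hc : 0 ≤ c) (h : ∀ k, q k ≠ 0 → (k : ℚ) ≤ c) :
    slope q ≤ c := by
  have : slope q ≤ (c.toNNRat : ℚ) := NNRat.coe_le_coe.2 <| Finset.sup_le fun k hk =>
    (Rat.toNNRat_le_toNNRat_iff hc).2 (h k (Finsupp.mem_support_iff.1 hk))
  rwa [Rat.coe_toNNRat _ hc] at this

theorem cutoff_comm (q q' : ExpFactor) : cutoff q q' = cutoff q' q := by
  unfold cutoff
  rw [Nat.lcm_comm]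
  simp only [eq_comm]

theorem exists_nat_of_ram_eq_one {q : ExpFactor} (hq : ram q = 1) {k : Exponent} (hk : q k ≠ 0) :
    ∃ m : ℕ, (k : ℚ) = m := by
  obtain ⟨j, hj⟩ := (ram_isLeast q).1.2 k (Finsupp.mem_support_iff.2 hk)
  exact ⟨j, by rw [hj, hq]; simp⟩

theorem ram_trunc_eq_one {q : ExpFactor} (hq : ram q = 1) (c : ℚ) : ram (trunc c q) = 1 := by
  have h : ram (trunc c q) ∣ ram q :=
    Finset.lcm_mono (by rw [trunc, Finsupp.support_filter]; exact Finset.filter_subset _ _)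
  rw [hq] at h
  exact Nat.dvd_one.1 h

/-- All exponents of `q` are integers, so every Galois factor `exp (2 π i n k)` equals 1 and the
orbit is a single point. -/
theorem eq_of_circ_eq {q q' : ExpFactor} (hq : ram q = 1) (h : circ q = circ q') : q = q' := by
  obtain ⟨n, hn⟩ := circ_eq_circ.1 h
  ext k
  rw [hn k]
  by_cases hk : q k = 0
  · rw [hk, mul_zero]
  · obtain ⟨m, hm⟩ := exists_nat_of_ram_eq_one hq hk
    have : Complex.exp (2 * Real.pi * Complex.I * n * ((k : ℚ) : ℂ)) = 1 := by
      rw [Complex.exp_eq_one_iff]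
      refine ⟨n * m, ?_⟩
      rw [hm]
      push_cast
      ring
    rw [this, one_mul]

/-- All the gcds equal 1, so the differences in the level sum vanish. -/
theorem edgeFormula_of_ram_eq_one {q q' : ExpFactor} (hq : ram q = 1) (hq' : ram q' = 1) :
    edgeFormula q q' = numer 1 (slope (diffPart q q')) - 1 := by
  have h : ∀ S, gcdOf 1 S = 1 := fun S => Nat.gcd_one_left _
  simp [edgeFormula, hq, hq', levelSum, h]

theorem edgeMult_of_ram_eq_one {q q' : ExpFactor} (hq : ram q = 1) (hq' : ram q' = 1) :
    edgeMult q q' = numer 1 (max (slope (diffPart q q')) (slope (diffPart q' q))) - 1 := by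
  unfold edgeMult
  split_ifs with h
  · rw [edgeFormula_of_ram_eq_one hq hq', max_eq_left h]
  · rw [edgeFormula_of_ram_eq_one hq' hq, max_eq_right (not_le.1 h).le]

theorem diffPart_apply (q q' : ExpFactor) (k : Exponent) :
    diffPart q q' k = if cutoff q q' ≤ k then 0 else q k := by
  by_cases h : cutoff q q' ≤ k <;> simp [diffPart, commonPart, trunc, h]

/-- For polynomials `q ≠ q'` without constant term, the edge multiplicity is `deg (q - q') - 1`. -/
theorem exists_edgeMult_eq {q q' : ExpFactor} (hq : ram q = 1) (hq' : ram q' = 1) (hne : q ≠ q') :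
    ∃ (d : ℚ) (hd : 0 < d), edgeMult q q' = ⌊d⌋₊ - 1 ∧ q ⟨d, hd⟩ ≠ q' ⟨d, hd⟩ ∧
      ∀ k : Exponent, d < k → q k = q' k := by
  have htr := eq_of_circ_eq (ram_trunc_eq_one hq _) (circ_trunc_cutoff q q')
  obtain ⟨N, hN, hmin⟩ : ∃ N : ℕ, cutoff q q' = N ∧
      ∀ m : ℕ, 0 < m → trunc m q = trunc m q' → N ≤ m := by
    refine ⟨sInf {m : ℕ | 0 < m ∧ circ (trunc m q) = circ (trunc m q')}, ?_,
      fun m hm h => Nat.sInf_le ⟨hm, congrArg circ h⟩⟩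
    unfold cutoff
    rw [hq, hq']
    simp only [Nat.lcm_self, Nat.cast_one, div_one]
  have hagree : ∀ k : Exponent, (N : ℚ) ≤ k → q k = q' k := by
    intro k hk
    rw [hN] at htr
    simpa [trunc, hk] using DFunLike.congr_fun htr k
  have hnat : ∀ k : Exponent, q k ≠ q' k → ∃ m : ℕ, (k : ℚ) = m := by
    intro k hk
    by_cases h : q k = 0
    · exact exists_nat_of_ram_eq_one hq' (fun h' => hk (h.trans h'.symm))
    · exact exists_nat_of_ram_eq_one hq h
  obtain ⟨k₀, hk₀⟩ := DFunLike.ne_iff.1 hne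
  obtain ⟨m₀, hm₀⟩ := hnat k₀ hk₀
  have hm₀pos : 0 < m₀ := by
    have := k₀.2
    rw [hm₀] at this
    exact_mod_cast this
  have hm₀N : m₀ < N := by
    by_contra h
    refine hk₀ (hagree k₀ ?_)
    rw [hm₀]
    exact_mod_cast not_lt.1 h
  -- The truncations agree from `N` on but not from `N - 1`, so `d = N - 1` is the degree of `q -
  -- q'`. It is positive because `0 < m₀ < N`, so minimality of `N` can be tested at `d`.
  obtain ⟨d, rfl⟩ : ∃ d, N = d + 1 := ⟨N - 1, by omega⟩
  have hd : 0 < d := by omega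
  have hdq : (0 : ℚ) < d := by exact_mod_cast hd
  have hlt : ∀ k : Exponent, (∃ m : ℕ, (k : ℚ) = m) → (k : ℚ) < (d + 1 : ℕ) → (k : ℚ) ≤ d := by
    rintro k ⟨m, hm⟩ h
    rw [hm] at h ⊢
    exact_mod_cast Nat.lt_succ_iff.1 (by exact_mod_cast h)
  have hdne : q ⟨d, hdq⟩ ≠ q' ⟨d, hdq⟩ := by
    intro h
    have : ¬ (d + 1 ≤ d) := by omega
    refine this (hmin d hd ?_)
    ext k
    by_cases hk : (d : ℚ) ≤ k
    · simp only [trunc, Finsupp.filter_apply, hk, if_true]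
      by_contra hkne
      have hk' : (k : ℚ) ≤ d := by
        refine hlt k (hnat k hkne) ?_
        by_contra hc
        exact hkne (hagree k (not_lt.1 hc))
      have : k = ⟨d, hdq⟩ := Subtype.ext (le_antisymm hk' hk)
      exact hkne (this ▸ h)
    · simp [trunc, hk]
  have hle : ∀ p p' : ExpFactor, ram p = 1 → cutoff p p' = (d + 1 : ℕ) →
      slope (diffPart p p') ≤ d := by
    intro p p' hp hc
    refine slope_le hdq.le fun k hk => ?_
    rw [diffPart_apply, hc] at hk
    split_ifs at hk with h
    · exact absurd rfl hk
    · exact hlt k (exists_nat_of_ram_eq_one hp hk) (not_le.1 h)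
  have hge : ∀ p p' : ExpFactor, cutoff p p' = (d + 1 : ℕ) → p ⟨d, hdq⟩ ≠ 0 →
      (d : ℚ) ≤ slope (diffPart p p') := by
    intro p p' hc hp
    refine le_slope (k := ⟨d, hdq⟩) ?_
    rw [diffPart_apply, hc, if_neg]
    · exact hp
    · push_cast
      simp
  have hN' : cutoff q' q = (d + 1 : ℕ) := by rw [cutoff_comm, hN]
  -- The coefficients at `z ^ d` differ, so at least one of them is nonzero; that factor has a
  -- different part of slope `d`, while neither slope exceeds `d`.
  have hmax : max (slope (diffPart q q')) (slope (diffPart q' q)) = d := by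
    refine le_antisymm (max_le (hle _ _ hq hN) (hle _ _ hq' hN')) ?_
    by_cases h : q ⟨d, hdq⟩ = 0
    · exact le_max_of_le_right (hge _ _ hN' fun h' => hdne (h.trans h'.symm))
    · exact le_max_of_le_left (hge _ _ hN h)
  refine ⟨d, hdq, ?_, hdne, fun k hk => ?_⟩
  · rw [edgeMult_of_ram_eq_one hq hq', hmax, numer]
    simp
  · by_contra hkne
    refine hk.not_ge (hlt k (hnat k hkne) ?_)
    by_contra hc
    exact hkne (hagree k (not_lt.1 hc))

/-- If `p` and `q` both agreed with `s` in degree `deg (p - q)`, they would agree with each other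
there. Monotonicity of the floor carries the bound on degrees over to multiplicities. -/
theorem mult_le_max_of_ram_eq_one {I J K : StokesCircle} (hI : I.ram = 1) (hJ : J.ram = 1)
    (hK : K.ram = 1) (hIJ : I ≠ J) (hIK : I ≠ K) (hJK : J ≠ K) :
    I.mult J ≤ max (I.mult K) (J.mult K) := by
  rw [StokesCircle.mult, StokesCircle.mult, StokesCircle.mult, if_neg hIJ, if_neg hIK, if_neg hJK]
  induction I using Quotient.inductionOn with | _ p
  induction J using Quotient.inductionOn with | _ q
  induction K using Quotient.inductionOn with | _ s
  change edgeMult p q ≤ max (edgeMult p s) (edgeMult q s)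
  change ram p = 1 at hI
  change ram q = 1 at hJ
  change ram s = 1 at hK
  obtain ⟨d₁, hd₁, e₁, hne, -⟩ := exists_edgeMult_eq hI hJ fun h => hIJ (congrArg circ h)
  obtain ⟨d₂, hd₂, e₂, -, h₂⟩ := exists_edgeMult_eq hI hK fun h => hIK (congrArg circ h)
  obtain ⟨d₃, hd₃, e₃, -, h₃⟩ := exists_edgeMult_eq hJ hK fun h => hJK (congrArg circ h)
  rw [e₁, e₂, e₃]
  have h : d₁ ≤ d₂ ∨ d₁ ≤ d₃ := by
    by_contra! h
    exact hne ((h₂ ⟨d₁, hd₁⟩ h.1).trans (h₃ ⟨d₁, hd₁⟩ h.2).symm)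
  rcases h with h | h
  · exact le_max_of_le_left (sub_le_sub_right (Int.ofNat_le.2 (Nat.floor_le_floor h)) 1)
  · exact le_max_of_le_right (sub_le_sub_right (Int.ofNat_le.2 (Nat.floor_le_floor h)) 1)

theorem Diagram.IsFissionGraph.isUltrametric {Γ : Diagram} (h : Γ.IsFissionGraph) :
    Γ.IsUltrametric := by
  obtain ⟨_, Θ, -, hΘ, e, he⟩ := h
  intro i j k hij hik hjk h₁ h₂
  have hne : ∀ {a b : Γ.N}, a ≠ b → (e a : StokesCircle) ≠ e b := fun hab h =>
    hab (e.injective (Subtype.ext h))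
  -- The inequality is applied to the largest edge `jk`, with `i` as the comparison vertex.
  have := mult_le_max_of_ram_eq_one (hΘ _ (e j).2) (hΘ _ (e k).2) (hΘ _ (e i).2) (hne hjk)
    (hne hij.symm) (hne hik.symm)
  rw [← he, ← he, ← he, Γ.symm j i, Γ.symm k i, max_eq_right h₁] at this
  exact le_antisymm h₂ this

/-! ### The triangle with edges 3, 4, 6 -/

theorem not_isUltrametric_triangle346 : ¬ triangle346.IsUltrametric := by
  intro h
  have h12 : (1 : Fin 3) ≠ 2 := by decide
  have h10 : (1 : Fin 3) ≠ 0 := by decide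
  have h20 : (2 : Fin 3) ≠ 0 := by decide
  have := h (2 : Fin 3) (1 : Fin 3) (0 : Fin 3) h12.symm h20 h10
    (show (3 : ℤ) ≤ 4 by norm_num) (show (4 : ℤ) ≤ 6 by norm_num)
  exact absurd (show (4 : ℤ) = 6 from this) (by norm_num)

theorem isGraph_triangle346 : triangle346.IsGraph := by
  constructor
  · intro i j
    change Fin 3 at i j
    fin_cases i <;> fin_cases j
    exacts [le_refl (0 : ℤ), show (0 : ℤ) ≤ 6 by norm_num, show (0 : ℤ) ≤ 4 by norm_num,
      show (0 : ℤ) ≤ 6 by norm_num, le_refl (0 : ℤ), show (0 : ℤ) ≤ 3 by norm_num,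
      show (0 : ℤ) ≤ 4 by norm_num, show (0 : ℤ) ≤ 3 by norm_num, le_refl (0 : ℤ)]
  · intro i
    change Fin 3 at i
    fin_cases i <;> rfl

end NAHodge

end

open NAHodge
theorem proposition3p3 :
    -- there exist nonabelian Hodge graphs that are not fission graphs
    (∃ Γ : Diagram, Γ.IsNonabelianHodgeGraph ∧ ¬ Γ.IsFissionGraph) ∧
    -- explicit connections on the affine line and their irregular classes
    (AlgConnection.ofMatrix (exampleMatrix 1 1 1)).HasIrregularClass
      {circ (mono (1 / 3) 3 (by norm_num)), circ (mono (3 / 4) (4 / 3) (by norm_num)),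
        circ (mono (2 / 3) (3 / 2) (by norm_num))} ∧
    (AlgConnection.ofMatrix (exampleMatrix 3 (64 / 27) (9 / 4))).HasIrregularClass
      {circ (mono 1 3 (by norm_num)), circ (mono 1 (4 / 3) (by norm_num)),
        circ (mono 1 (3 / 2) (by norm_num))} ∧
    -- the multiplicities for `I = ⟨z ^ 3⟩`, `J = ⟨z ^ (4/3)⟩`, `K = ⟨z ^ (3/2)⟩`
    (∀ I J K : StokesCircle, I = circ (mono 1 3 (by norm_num)) →
      J = circ (mono 1 (4 / 3) (by norm_num)) → K = circ (mono 1 (3 / 2) (by norm_num)) →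
      I ≠ J ∧ I ≠ K ∧ J ≠ K ∧ I.mult I = 0 ∧ J.mult J = 0 ∧ K.mult K = 0 ∧
        I.mult J = 6 ∧ J.mult K = 3 ∧ K.mult I = 4) ∧
    -- the core diagram of both irregular classes is the triangle
    triangle346.IsCoreDiagramOf
      {circ (mono (1 / 3) 3 (by norm_num)), circ (mono (3 / 4) (4 / 3) (by norm_num)),
        circ (mono (2 / 3) (3 / 2) (by norm_num))} ∧
    triangle346.IsCoreDiagramOf
      {circ (mono 1 3 (by norm_num)), circ (mono 1 (4 / 3) (by norm_num)),
        circ (mono 1 (3 / 2) (by norm_num))} ∧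
    -- the triangle violates the ultrametric condition, is a nonabelian Hodge graph, and is not a
    -- fission graph
    ¬ triangle346.IsUltrametric ∧
    triangle346.IsNonabelianHodgeGraph ∧ ¬ triangle346.IsFissionGraph := by
  have h1 : (AlgConnection.ofMatrix (exampleMatrix 1 1 1)).HasIrregularClass
      {circ (mono (1 / 3) 3 (by norm_num)), circ (mono (3 / 4) (4 / 3) (by norm_num)),
        circ (mono (2 / 3) (3 / 2) (by norm_num))} := by
    have := hasIrregularClass_exampleMatrix 1 1 1 one_ne_zero one_ne_zero one_ne_zero
    simpa only [one_pow, mul_one] using this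
  have h2 : (AlgConnection.ofMatrix (exampleMatrix 3 (64 / 27) (9 / 4))).HasIrregularClass
      {circ (mono 1 3 (by norm_num)), circ (mono 1 (4 / 3) (by norm_num)),
        circ (mono 1 (3 / 2) (by norm_num))} := by
    -- These values make the coefficients `a / 3`, `3 / 4 * β` and `2 / 3 * γ` all equal to 1.
    have := hasIrregularClass_exampleMatrix 3 (4 / 3) (3 / 2) (by norm_num) (by norm_num)
      (by norm_num)
    have e1 : (4 / 3 : ℂ) ^ 3 = 64 / 27 := by norm_num
    have e2 : (3 / 2 : ℂ) ^ 2 = 9 / 4 := by norm_num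
    have e3 : (3 / 3 : ℂ) = 1 := by norm_num
    have e4 : (3 / 4 * (4 / 3) : ℂ) = 1 := by norm_num
    have e5 : (2 / 3 * (3 / 2) : ℂ) = 1 := by norm_num
    rwa [e1, e2, e3, e4, e5] at this
  have hcore := isCoreDiagramOf_triangle346 (one_ne_zero (α := ℂ)) (one_ne_zero (α := ℂ))
    (one_ne_zero (α := ℂ))
  have hgraph : triangle346.IsNonabelianHodgeGraph := ⟨⟨_, _, h2, hcore⟩, isGraph_triangle346⟩
  have hfission : ¬ triangle346.IsFissionGraph := fun h =>
    not_isUltrametric_triangle346 h.isUltrametric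
  refine ⟨⟨_, hgraph, hfission⟩, h1, h2, ?_,
    isCoreDiagramOf_triangle346 (by norm_num) (by norm_num) (by norm_num), hcore,
    not_isUltrametric_triangle346, hgraph, hfission⟩
  intro I J K hI hJ hK
  obtain ⟨⟨n1, n2, n3⟩, ⟨l1, l2, l3⟩, ⟨m1, m2, m3⟩, -⟩ :=
    mult_example one_ne_zero one_ne_zero one_ne_zero I J K hI hJ hK
  exact ⟨n1, n2, n3, l1, l2, l3, m1, m2, m3⟩
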